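/- Theorem 3.2. Let $G=(V,E)$ be a finite connected undirected graph without loops, with at least two vertices and with $(i,j),(j,i)\in E$ for every edge, let $N(i)=\{j\in V\mid (i,j)\in E\}$, and let $\Delta x>0$, $\beta>0$, $(v_i)_{i\in V}\in\mathbb R^V$ and a symmetric real matrix $(w_{ij})_{i,j\in V}$ be given. Write $(\cdot)_+=\max\{\cdot,0\}$, let $$\mathcal P_o(G)=\Big\{\rho\in\mathbb R^V\ \Big|\ \sum_{i\in V}\rho_i=1,\ \rho_i>0\text{ for all } i\in V\Big\},$$ $$\mathcal F(\rho)=\sum_{i} v_i\rho_i+\tfrac12\sum_{i,j} w_{ij}\rho_i\rho_j+\beta\sum_i\rho_i\log\rho_i,\qquad F_i(\rho)=\frac{\partial\mathcal F}{\partial\rho_i}(\rho),$$ and consider on $\mathcal P_o(G)$ the ordinary differential equation $$\frac{d\rho_i}{dt}=\frac{1}{\Delta x^2}\Big\{\sum_{j\in N(i)}\rho_j\,(F_j(\rho)-F_i(\rho))_+-\sum_{j\in N(i)}\rho_i\,(F_i(\rho)-F_j(\rho))_+\Big\},\qquad i\in V. \tag{a1}$$ For $\rho\in\mathcal P_o(G)$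 put $f_{ij}=\frac{\partial^2\mathcal F}{\partial\rho_i\partial\rho_j}(\rho)$, $h_{ij,kl}=\frac{f_{ik}+f_{jl}-f_{il}-f_{jk}}{\Delta x^2}$ and $$\lambda_{\mathcal F}(\rho)=\min_{\Phi\in D}\ \sum_{(i,j)\in E}\sum_{(k,l)\in E}h_{ij,kl}\Big(\frac{\Phi_i-\Phi_j}{\Delta x}\Big)_+\rho_i\Big(\frac{\Phi_k-\Phi_l}{\Delta x}\Big)_+\rho_k,$$ $$D=\Big\{\Phi\in\mathbb R^V\ \Big|\ \sum_{(i,j)\in E}\Big(\frac{\Phi_i-\Phi_j}{\Delta x}\Big)_+^2\rho_i=1\Big\}.$$ Let $\rho:[0,\infty)\to\mathcal P_o(G)$ be a solution of (a1) with $\rho(0)=\rho^0$ and $\lim_{t\to\infty}\rho(t)=\rho^\infty$, where $\rho^\infty\in\mathcal P_o(G)$ is an isolated equilibrium of (a1) (isolated among the equilibria of (a1) in $\mathcal P_o(G)$), and assume that $\lambda_{\mathcal F}(\rho^\infty)>0$. Then there is a constant $C>0$, depending only on $\rho^0$ and on the fixed data $G,\Delta x,\beta,v,w$, such that for all $t\ge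 0$ $$\mathcal F(\rho(t))-\mathcal F(\rho^\infty)\le e^{-Ct}\big(\mathcal F(\rho^0)-\mathcal F(\rho^\infty)\big).$$ Moreover, for every $\epsilon>0$ there is a time $T>0$, depending only on $\epsilon$, $\rho^0$ and the same fixed data, such that for all $t>T$ $$\mathcal F(\rho(t))-\mathcal F(\rho^\infty)\le e^{-2(\lambda_{\mathcal F}(\rho^\infty)-\epsilon)(t-T)}\big(\mathcal F(\rho(T))-\mathcal F(\rho^\infty)\big).$$ -/

import Mathlib

open Filter Topology

namespace DiscreteFP

noncomputable section

/-- The open probability simplex `𝒫ₒ(G)` on the vertex set `V`: strictly positive weights of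
total mass one. -/
def openSimplex (V : Type*) [Fintype V] : Set (V → ℝ) :=
  {ρ | ∑ i, ρ i = 1 ∧ ∀ i, 0 < ρ i}

/-- The partial derivative `∂f/∂ρ_i` at `ρ`. -/
def partialDeriv {V : Type*} [DecidableEq V] (i : V) (f : (V → ℝ) → ℝ) (ρ : V → ℝ) : ℝ :=
  lineDeriv ℝ f ρ (Pi.single i 1)

/-- The discrete free energy
`ℱ(ρ) = ∑ v_i ρ_i + (1/2) ∑ w_ij ρ_i ρ_j + β ∑ ρ_i log ρ_i`. -/
def freeEnergy {V : Type*} [Fintype V] (v : V → ℝ) (w : Matrix V V ℝ) (β : ℝ)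
    (ρ : V → ℝ) : ℝ :=
  ∑ i, v i * ρ i + (1 / 2) * ∑ i, ∑ j, w i j * ρ i * ρ j + β * ∑ i, ρ i * Real.log (ρ i)

/-- The right-hand side of the scheme at the vertex `i`, where `F_i = ∂ℱ/∂ρ_i`:
`Δx⁻² (∑_{j ∈ N(i)} ρ_j (F_j - F_i)₊ - ∑_{j ∈ N(i)} ρ_i (F_i - F_j)₊)`. -/
def schemeRHS {V : Type*} [Fintype V] [DecidableEq V] (G : SimpleGraph V) [DecidableRel G.Adj]
    (dx : ℝ) (F : (V → ℝ) → ℝ) (ρ : V → ℝ) : V → ℝ := fun i =>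
  (1 / dx ^ 2) *
    (∑ j ∈ G.neighborFinset i, ρ j * max (partialDeriv j F ρ - partialDeriv i F ρ) 0
      - ∑ j ∈ G.neighborFinset i, ρ i * max (partialDeriv i F ρ - partialDeriv j F ρ) 0)

/-- `ρ : [0, ∞) → 𝒫ₒ(G)` solves the scheme with initial value `ρ₀`. Only the values of `ρ` at
times `t ≥ 0` matter, and the derivative at time `0` is one-sided. -/
def IsSolution {V : Type*} [Fintype V] [DecidableEq V] (G : SimpleGraph V) [DecidableRel G.Adj]
    (dx : ℝ) (F : (V → ℝ) → ℝ) (ρ₀ : V → ℝ) (ρ : ℝ → V → ℝ) : Prop :=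
  ρ 0 = ρ₀ ∧
    ∀ t : ℝ, 0 ≤ t → ρ t ∈ openSimplex V ∧
      HasDerivWithinAt ρ (schemeRHS G dx F (ρ t)) (Set.Ici 0) t

/-- The equilibria of the scheme: points of `𝒫ₒ(G)` at which the right-hand side vanishes. -/
def equilibria {V : Type*} [Fintype V] [DecidableEq V] (G : SimpleGraph V) [DecidableRel G.Adj]
    (dx : ℝ) (F : (V → ℝ) → ℝ) : Set (V → ℝ) :=
  {ρ | ρ ∈ openSimplex V ∧ schemeRHS G dx F ρ = 0}

/-- `ρ` is an equilibrium, and no other point of some neighbourhood of `ρ` is one. -/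
def IsIsolatedEquilibrium {V : Type*} [Fintype V] [DecidableEq V] (G : SimpleGraph V)
    [DecidableRel G.Adj] (dx : ℝ) (F : (V → ℝ) → ℝ) (ρ : V → ℝ) : Prop :=
  ρ ∈ equilibria G dx F ∧ ∀ᶠ σ in 𝓝[≠] ρ, σ ∉ equilibria G dx F

/-- The second partial derivative `f_ij = ∂²F/∂ρ_i∂ρ_j` at `ρ`. -/
def hess {V : Type*} [DecidableEq V] (F : (V → ℝ) → ℝ) (ρ : V → ℝ) (i j : V) : ℝ :=
  partialDeriv i (partialDeriv j F) ρ

/-- `h_{ij,kl} = (f_ik + f_jl - f_il - f_jk) / Δx²`. -/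
def hCoeff {V : Type*} [DecidableEq V] (dx : ℝ) (F : (V → ℝ) → ℝ) (ρ : V → ℝ)
    (i j k l : V) : ℝ :=
  (hess F ρ i k + hess F ρ j l - hess F ρ i l - hess F ρ j k) / dx ^ 2

/-- The sum over pairs of ordered edges
`∑_{(i,j) ∈ E} ∑_{(k,l) ∈ E} h_{ij,kl} ((Φ_i - Φ_j)/Δx)₊ ρ_i ((Φ_k - Φ_l)/Δx)₊ ρ_k`. -/
def rateForm {V : Type*} [Fintype V] [DecidableEq V] (G : SimpleGraph V) [DecidableRel G.Adj]
    (dx : ℝ) (F : (V → ℝ) → ℝ) (ρ Φ : V → ℝ) : ℝ :=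
  ∑ i, ∑ j ∈ G.neighborFinset i, ∑ k, ∑ l ∈ G.neighborFinset k,
    hCoeff dx F ρ i j k l * max ((Φ i - Φ j) / dx) 0 * ρ i * max ((Φ k - Φ l) / dx) 0 * ρ k

/-- The set `D` of potentials with `∑_{(i,j) ∈ E} ((Φ_i - Φ_j)/Δx)₊² ρ_i = 1`. -/
def unitPotentials {V : Type*} [Fintype V] (G : SimpleGraph V) [DecidableRel G.Adj]
    (dx : ℝ) (ρ : V → ℝ) : Set (V → ℝ) :=
  {Φ | ∑ i, ∑ j ∈ G.neighborFinset i, max ((Φ i - Φ j) / dx) 0 ^ 2 * ρ i = 1}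

/-- The dissipation rate `λ_F(ρ)`, the minimum of `rateForm` over `D`. For a connected graph with
at least two vertices and `ρ ∈ 𝒫ₒ(G)`, the set `D` is non-empty and compact modulo additive
constants, so that the infimum is a minimum. -/
def dissipationRate {V : Type*} [Fintype V] [DecidableEq V] (G : SimpleGraph V)
    [DecidableRel G.Adj] (dx : ℝ) (F : (V → ℝ) → ℝ) (ρ : V → ℝ) : ℝ :=
  sInf (rateForm G dx F ρ '' unitPotentials G dx ρ)

end

end DiscreteFP

set_option linter.unusedSectionVars false

namespace DiscreteFP

noncomputable section

variable {V : Type*} [Fintype V] [DecidableEq V]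

/-! ### Derivatives of the free energy -/

/-! Entropy method. Along a solution put `y = F(ρ) - F(ρ')`, where `ρ'` is the limit. Discrete
integration by parts gives `y' = -d`, where `d` is the `dissipation` of the chemical potential.
Differentiating once more, `d'` is `-2 * rateForm` plus a term whose weights are `dρ/dt`. By
homogeneity `rateForm` at `ρ'` dominates `dissipationRate` times the dissipation. As `ρ → ρ'`, both
the change of coefficients and `dρ/dt` tend to zero, so `d' ≤ -2(λ - ε) d` for large `t`.

Integrating this up to infinity, where `y` and `d` vanish, gives `2(λ - ε) y ≤ d`, and Gronwall's
inequality gives the asymptotic rate. For a bound from time zero, the remaining compact interval is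
treated by the minimum of `d`. If `d` vanishes somewhere, the solution meets an equilibrium there
and is constant by uniqueness, which holds because the right-hand side is locally Lipschitz.
Uniqueness also makes the constants depend on the initial value and not on a chosen trajectory. -/

/-- The explicit first partial derivative of the free energy. -/
def chemPot (v : V → ℝ) (w : Matrix V V ℝ) (β : ℝ) (ρ : V → ℝ) (i : V) : ℝ :=
  v i + ∑ j, w i j * ρ j + β * (Real.log (ρ i) + 1)

/-- The explicit second partial derivative of the free energy. -/
def chemHess (w : Matrix V V ℝ) (β : ℝ) (ρ : V → ℝ) (i k : V) : ℝ :=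
  w i k + if i = k then β / ρ i else 0

theorem hasFDerivAt_freeEnergy {v : V → ℝ} {w : Matrix V V ℝ} (hw : w.IsSymm) {β : ℝ}
    {ρ : V → ℝ} (hρ : ∀ i, ρ i ≠ 0) :
    HasFDerivAt (freeEnergy v w β)
      (∑ i, chemPot v w β ρ i • (ContinuousLinearMap.proj i : (V → ℝ) →L[ℝ] ℝ)) ρ := by
  have hp (i : V) : HasFDerivAt (fun σ : V → ℝ => σ i)
      (ContinuousLinearMap.proj i : (V → ℝ) →L[ℝ] ℝ) ρ := hasFDerivAt_apply i ρ
  have h1 := HasFDerivAt.fun_sum (u := Finset.univ) fun i _ => (hp i).const_mul (v i)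
  have h2 := (HasFDerivAt.fun_sum (u := Finset.univ) fun i _ =>
    HasFDerivAt.fun_sum (u := Finset.univ) fun j _ =>
      ((hp i).const_mul (w i j)).mul (hp j)).const_mul (1 / 2)
  have h3 := (HasFDerivAt.fun_sum (u := Finset.univ) fun i _ =>
    (hp i).mul ((hp i).log (hρ i))).const_mul β
  refine ((h1.add h2).add h3).congr_fderiv ?_
  ext x
  simp only [add_apply, sum_apply,
    smul_apply, ContinuousLinearMap.proj_apply, smul_eq_mul, chemPot]
  have hs : ∑ i, ∑ j, (w i j * ρ i * x j + ρ j * (w i j * x i))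
      = 2 * ∑ i, ∑ j, w i j * ρ j * x i := by
    simp only [Finset.sum_add_distrib]
    rw [Finset.sum_comm, two_mul]
    congr 1
    · refine Finset.sum_congr rfl fun i _ => Finset.sum_congr rfl fun j _ => ?_
      rw [hw.apply i j]
    · refine Finset.sum_congr rfl fun i _ => Finset.sum_congr rfl fun j _ => ?_
      ring
  rw [hs]
  simp only [Finset.mul_sum, ← Finset.sum_add_distrib]
  refine Finset.sum_congr rfl fun i _ => ?_
  have := hρ i
  rw [add_mul, add_mul, Finset.sum_mul]
  congr 1
  · congr 1
    refine Finset.sum_congr rfl fun j _ => ?_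
    ring
  · field_simp
    ring

theorem partialDeriv_freeEnergy {v : V → ℝ} {w : Matrix V V ℝ} (hw : w.IsSymm) {β : ℝ}
    {ρ : V → ℝ} (hρ : ∀ i, ρ i ≠ 0) (i : V) :
    partialDeriv i (freeEnergy v w β) ρ = chemPot v w β ρ i := by
  rw [partialDeriv, ((hasFDerivAt_freeEnergy hw hρ).hasLineDerivAt _).lineDeriv]
  simp [Pi.single_apply]

theorem hasFDerivAt_chemPot (v : V → ℝ) (w : Matrix V V ℝ) (β : ℝ)
    {ρ : V → ℝ} (hρ : ∀ i, ρ i ≠ 0) (i : V) :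
    HasFDerivAt (fun σ => chemPot v w β σ i)
      (∑ k, chemHess w β ρ i k • (ContinuousLinearMap.proj k : (V → ℝ) →L[ℝ] ℝ)) ρ := by
  have hp (i : V) : HasFDerivAt (fun σ : V → ℝ => σ i)
      (ContinuousLinearMap.proj i : (V → ℝ) →L[ℝ] ℝ) ρ := hasFDerivAt_apply i ρ
  have h1 := HasFDerivAt.fun_sum (u := Finset.univ) fun j _ => (hp j).const_mul (w i j)
  have h3 := (((hp i).log (hρ i)).add_const 1).const_mul β
  refine ((h1.const_add (v i)).add h3).congr_fderiv ?_
  ext x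
  simp [chemHess, add_mul, Finset.sum_add_distrib, ite_mul, div_eq_mul_inv, mul_assoc]

theorem eventually_ne_zero {ρ : V → ℝ} (hρ : ∀ i, ρ i ≠ 0) :
    ∀ᶠ σ in 𝓝 ρ, ∀ i, σ i ≠ 0 :=
  eventually_all.2 fun i => (continuous_apply i).continuousAt.eventually_ne (hρ i)

theorem hess_freeEnergy {v : V → ℝ} {w : Matrix V V ℝ} (hw : w.IsSymm) {β : ℝ}
    {ρ : V → ℝ} (hρ : ∀ i, ρ i ≠ 0) (i k : V) :
    hess (freeEnergy v w β) ρ i k = chemHess w β ρ k i := by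
  have h : partialDeriv k (freeEnergy v w β) =ᶠ[𝓝 ρ] fun σ => chemPot v w β σ k :=
    (eventually_ne_zero hρ).mono fun σ hσ => partialDeriv_freeEnergy hw hσ k
  rw [hess, partialDeriv, h.lineDeriv_eq,
    ((hasFDerivAt_chemPot v w β hρ k).hasLineDerivAt _).lineDeriv]
  simp [Pi.single_apply]

theorem chemHess_comm {w : Matrix V V ℝ} (hw : w.IsSymm) (β : ℝ) (ρ : V → ℝ) (i k : V) :
    chemHess w β ρ i k = chemHess w β ρ k i := by
  rw [chemHess, chemHess, hw.apply k i]
  by_cases h : i = k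
  · subst h; rfl
  · rw [if_neg h, if_neg (Ne.symm h)]

/-! ### Sums over ordered edges -/

/-- The positive part of the discrete gradient along `(i, j)`. -/
def posGrad (dx : ℝ) (Φ : V → ℝ) (i j : V) : ℝ := max ((Φ i - Φ j) / dx) 0

/-- The weighted sum `∑_{(i,j) ∈ E} ((Φ_i - Φ_j)/Δx)₊² ρ_i`. -/
def dissipation (G : SimpleGraph V) [DecidableRel G.Adj] (dx : ℝ) (ρ Φ : V → ℝ) : ℝ :=
  ∑ i, ∑ j ∈ G.neighborFinset i, posGrad dx Φ i j ^ 2 * ρ i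

theorem posGrad_nonneg (dx : ℝ) (Φ : V → ℝ) (i j : V) : 0 ≤ posGrad dx Φ i j := le_max_right _ _

theorem posGrad_smul (dx : ℝ) (Φ : V → ℝ) {c : ℝ} (hc : 0 ≤ c) (i j : V) :
    posGrad dx (c • Φ) i j = c * posGrad dx Φ i j := by
  rw [posGrad, posGrad, mul_max_of_nonneg _ _ hc, mul_zero]
  simp only [Pi.smul_apply, smul_eq_mul]
  congr 1
  ring

variable (G : SimpleGraph V) [DecidableRel G.Adj] (dx : ℝ)

theorem edge_sum_comm (g : V → V → ℝ) :
    ∑ i, ∑ j ∈ G.neighborFinset i, g i j = ∑ i, ∑ j ∈ G.neighborFinset i, g j i :=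
  Finset.sum_comm' (by simp [G.adj_comm])

theorem schemeRHS_eq {dx : ℝ} (hdx : 0 < dx) (F : (V → ℝ) → ℝ) (ρ : V → ℝ) {p : V → ℝ}
    (hp : ∀ i, partialDeriv i F ρ = p i) (i : V) :
    schemeRHS G dx F ρ i = 1 / dx * (∑ j ∈ G.neighborFinset i, posGrad dx p j i * ρ j
      - ∑ j ∈ G.neighborFinset i, posGrad dx p i j * ρ i) := by
  have key (a b : V) : max (p a - p b) 0 = dx * posGrad dx p a b := by
    rw [posGrad, mul_max_of_nonneg _ _ hdx.le, mul_zero, mul_div_cancel₀ _ hdx.ne']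
  simp only [schemeRHS, hp, key, ← Finset.sum_sub_distrib, Finset.mul_sum]
  refine Finset.sum_congr rfl fun j _ => ?_
  field_simp

/-- Discrete integration by parts: reversing the edges in the inflow sum turns it into an outflow
sum, and the two combine into differences of `g`. -/
theorem sum_mul_schemeRHS {dx : ℝ} (hdx : 0 < dx) (F : (V → ℝ) → ℝ) (ρ : V → ℝ) {p : V → ℝ}
    (hp : ∀ i, partialDeriv i F ρ = p i) (g : V → ℝ) :
    ∑ i, g i * schemeRHS G dx F ρ i =
      - ∑ i, ∑ j ∈ G.neighborFinset i, (g i - g j) / dx * (posGrad dx p i j * ρ i) := by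
  simp only [schemeRHS_eq G hdx F ρ hp, mul_sub, Finset.sum_sub_distrib, Finset.mul_sum]
  rw [edge_sum_comm G (fun i j => g i * (1 / dx * (posGrad dx p j i * ρ j))),
    ← Finset.sum_sub_distrib, ← Finset.sum_neg_distrib]
  refine Finset.sum_congr rfl fun i _ => ?_
  rw [← Finset.sum_sub_distrib, ← Finset.sum_neg_distrib]
  refine Finset.sum_congr rfl fun j _ => ?_
  ring

theorem sum_mul_schemeRHS_eq_neg_dissipation {dx : ℝ} (hdx : 0 < dx) (F : (V → ℝ) → ℝ)
    (ρ : V → ℝ) {p : V → ℝ} (hp : ∀ i, partialDeriv i F ρ = p i) :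
    ∑ i, p i * schemeRHS G dx F ρ i = - dissipation G dx ρ p := by
  rw [sum_mul_schemeRHS G hdx F ρ hp, dissipation]
  congr 1
  refine Finset.sum_congr rfl fun i _ => Finset.sum_congr rfl fun j _ => ?_
  rw [posGrad]
  rcases le_total ((p i - p j) / dx) 0 with h | h
  · rw [max_eq_right h]; ring
  · rw [max_eq_left h]; ring

/-! ### Scaling and comparison of weights in the dissipation -/

theorem dissipation_smul {c : ℝ} (hc : 0 ≤ c) (ρ Φ : V → ℝ) :
    dissipation G dx ρ (c • Φ) = c ^ 2 * dissipation G dx ρ Φ := by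
  simp only [dissipation, posGrad_smul dx Φ hc, Finset.mul_sum]
  refine Finset.sum_congr rfl fun i _ => Finset.sum_congr rfl fun j _ => ?_
  ring

/-- The dissipation is linear in the weights with nonnegative coefficients. No sign is imposed on
the weights, so `dρ/dt` and `ρ - ρ'` are admissible. -/
theorem dissipation_le_mul {ρ σ : V → ℝ} {c : ℝ} (h : ∀ i, ρ i ≤ c * σ i) (Φ : V → ℝ) :
    dissipation G dx ρ Φ ≤ c * dissipation G dx σ Φ := by
  simp only [dissipation, Finset.mul_sum]
  refine Finset.sum_le_sum fun i _ => Finset.sum_le_sum fun j _ => ?_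
  nlinarith [mul_le_mul_of_nonneg_left (h i) (sq_nonneg (posGrad dx Φ i j))]

theorem dissipation_le_sum_abs (σ Φ : V → ℝ) :
    dissipation G dx σ Φ ≤ (∑ i, |σ i|) * dissipation G dx 1 Φ := by
  refine dissipation_le_mul G dx (fun i => ?_) Φ
  rw [Pi.one_apply, mul_one]
  exact (le_abs_self _).trans
    (Finset.single_le_sum (f := fun i => |σ i|) (fun i _ => abs_nonneg _) (Finset.mem_univ i))

theorem dissipation_one_le {ρ : V → ℝ} (hρ : ∀ i, 0 < ρ i) (Φ : V → ℝ) :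
    dissipation G dx 1 Φ ≤ (∑ i, 1 / ρ i) * dissipation G dx ρ Φ := by
  refine dissipation_le_mul G dx (fun i => ?_) Φ
  have h : 1 / ρ i ≤ ∑ i, 1 / ρ i :=
    Finset.single_le_sum (f := fun i => 1 / ρ i) (fun i _ => (one_div_pos.2 (hρ i)).le)
      (Finset.mem_univ i)
  rw [Pi.one_apply]
  exact (div_le_iff₀ (hρ i)).1 h

theorem dissipation_nonneg {ρ : V → ℝ} (hρ : ∀ i, 0 ≤ ρ i) (Φ : V → ℝ) :
    0 ≤ dissipation G dx ρ Φ :=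
  Finset.sum_nonneg fun i _ => Finset.sum_nonneg fun _ _ => mul_nonneg (sq_nonneg _) (hρ i)

theorem dissipation_sub (ρ σ Φ : V → ℝ) :
    dissipation G dx (ρ - σ) Φ = dissipation G dx ρ Φ - dissipation G dx σ Φ := by
  simp only [dissipation, Pi.sub_apply, mul_sub, Finset.sum_sub_distrib]

theorem posGrad_sq_le {i j : V} (h : j ∈ G.neighborFinset i) (Φ : V → ℝ) :
    posGrad dx Φ i j ^ 2 ≤ dissipation G dx 1 Φ := by
  have h1 := Finset.single_le_sum
    (f := fun i => ∑ j ∈ G.neighborFinset i, posGrad dx Φ i j ^ 2 * (1 : V → ℝ) i)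
    (fun i _ => Finset.sum_nonneg fun j _ => by simpa using sq_nonneg _) (Finset.mem_univ i)
  refine le_trans ?_ h1
  have h2 := Finset.single_le_sum (s := G.neighborFinset i)
    (f := fun j => posGrad dx Φ i j ^ 2 * (1 : V → ℝ) i)
    (fun j _ => by simpa using sq_nonneg _) h
  simpa using h2

theorem posGrad_eq_zero {ρ : V → ℝ} (hρ : ∀ i, 0 < ρ i) {Φ : V → ℝ}
    (h0 : dissipation G dx ρ Φ = 0) {i j : V} (h : j ∈ G.neighborFinset i) :
    posGrad dx Φ i j = 0 := by
  have h1 := (posGrad_sq_le G dx h Φ).trans (dissipation_one_le G dx hρ Φ)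
  rw [h0, mul_zero] at h1
  exact pow_eq_zero_iff two_ne_zero |>.1 (le_antisymm h1 (sq_nonneg _))

/-! ### Quadratic forms on pairs of edges and coercivity -/

/-- The quadruple sum of `|c i j k l|` over pairs of ordered edges. -/
def edgeNorm (c : V → V → V → V → ℝ) : ℝ :=
  ∑ i, ∑ j ∈ G.neighborFinset i, ∑ k, ∑ l ∈ G.neighborFinset k, |c i j k l|

/-- The quadratic form in the positive gradients with coefficients `c`. -/
def edgeForm (c : V → V → V → V → ℝ) (Φ : V → ℝ) : ℝ :=
  ∑ i, ∑ j ∈ G.neighborFinset i, ∑ k, ∑ l ∈ G.neighborFinset k,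
    c i j k l * (posGrad dx Φ i j * posGrad dx Φ k l)

/-- Each product of two positive gradients is at most half the sum of their squares, and each square
is at most the dissipation with unit weights. -/
theorem neg_edgeForm_le (c : V → V → V → V → ℝ) (Φ : V → ℝ) :
    -edgeForm G dx c Φ ≤ edgeNorm G c * dissipation G dx 1 Φ := by
  simp only [edgeForm, edgeNorm, Finset.sum_mul, ← Finset.sum_neg_distrib]
  refine Finset.sum_le_sum fun i _ => Finset.sum_le_sum fun j hj => Finset.sum_le_sum fun k _ =>
    Finset.sum_le_sum fun l hl => ?_
  have h1 := posGrad_sq_le G dx hj Φ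
  have h2 := posGrad_sq_le G dx hl Φ
  have h3 := posGrad_nonneg dx Φ i j
  have h4 := posGrad_nonneg dx Φ k l
  rw [← neg_mul]
  refine mul_le_mul (neg_le_abs _) ?_ (mul_nonneg h3 h4) (abs_nonneg _)
  nlinarith [sq_nonneg (posGrad dx Φ i j - posGrad dx Φ k l)]

theorem edgeForm_sub (c d : V → V → V → V → ℝ) (Φ : V → ℝ) :
    edgeForm G dx (fun i j k l => c i j k l - d i j k l) Φ
      = edgeForm G dx c Φ - edgeForm G dx d Φ := by
  simp only [edgeForm, sub_mul, Finset.sum_sub_distrib]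

/-- The coefficients of `rateForm` as a quadratic form in the positive gradients. -/
def rateCoeff (F : (V → ℝ) → ℝ) (ρ : V → ℝ) (i j k l : V) : ℝ :=
  hCoeff dx F ρ i j k l * ρ i * ρ k

theorem rateForm_eq (F : (V → ℝ) → ℝ) (ρ Φ : V → ℝ) :
    rateForm G dx F ρ Φ = edgeForm G dx (rateCoeff dx F ρ) Φ := by
  refine Finset.sum_congr rfl fun i _ => Finset.sum_congr rfl fun j _ =>
    Finset.sum_congr rfl fun k _ => Finset.sum_congr rfl fun l _ => ?_
  rw [rateCoeff, posGrad, posGrad]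
  ring

theorem edgeForm_smul (c : V → V → V → V → ℝ) {a : ℝ} (ha : 0 ≤ a) (Φ : V → ℝ) :
    edgeForm G dx c (a • Φ) = a ^ 2 * edgeForm G dx c Φ := by
  simp only [edgeForm, posGrad_smul dx Φ ha, Finset.mul_sum]
  refine Finset.sum_congr rfl fun i _ => Finset.sum_congr rfl fun j _ =>
    Finset.sum_congr rfl fun k _ => Finset.sum_congr rfl fun l _ => ?_
  ring

/-- Coercivity of `rateForm` with the constant `dissipationRate`. -/
theorem dissipationRate_mul_le (F : (V → ℝ) → ℝ) {ρ : V → ℝ} (hρ : ∀ i, 0 < ρ i) (Φ : V → ℝ) :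
    dissipationRate G dx F ρ * dissipation G dx ρ Φ ≤ rateForm G dx F ρ Φ := by
  rcases (dissipation_nonneg G dx (fun i => (hρ i).le) Φ).eq_or_lt' with h0 | h0
  · rw [h0, mul_zero, rateForm_eq, edgeForm]
    refine (Finset.sum_eq_zero fun i _ => Finset.sum_eq_zero fun j hj =>
      Finset.sum_eq_zero fun k _ => Finset.sum_eq_zero fun l _ => ?_).ge
    rw [posGrad_eq_zero G dx hρ h0 hj]
    ring
  -- The real `sInf` is a lower bound only for a set bounded below; otherwise it defaults to zero.
  · have hb : BddBelow (rateForm G dx F ρ '' unitPotentials G dx ρ) := by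
      refine ⟨-(edgeNorm G (rateCoeff dx F ρ) * ∑ i, 1 / ρ i), ?_⟩
      rintro _ ⟨Ψ, hΨ, rfl⟩
      rw [rateForm_eq, neg_le]
      refine (neg_edgeForm_le G dx _ Ψ).trans ?_
      refine mul_le_mul_of_nonneg_left ?_ ?_
      · have h1 : dissipation G dx ρ Ψ = 1 := hΨ
        simpa [h1] using dissipation_one_le G dx hρ Ψ
      · exact Finset.sum_nonneg fun i _ => Finset.sum_nonneg fun j _ =>
          Finset.sum_nonneg fun k _ => Finset.sum_nonneg fun l _ => abs_nonneg _
    set d := dissipation G dx ρ Φ with hd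
    -- Both sides are homogeneous of degree two under nonnegative scaling, so `Φ` is normalised into
    -- the constraint set.
    have ha : 0 ≤ (√d)⁻¹ := by positivity
    have hsq : ((√d)⁻¹) ^ 2 = d⁻¹ := by rw [inv_pow, Real.sq_sqrt h0.le]
    have hmem : (√d)⁻¹ • Φ ∈ unitPotentials G dx ρ := by
      change dissipation G dx ρ _ = 1
      rw [dissipation_smul G dx ha, hsq, ← hd, inv_mul_cancel₀ h0.ne']
    have h1 := csInf_le hb (Set.mem_image_of_mem _ hmem)
    rw [rateForm_eq, edgeForm_smul G dx _ ha, hsq, ← rateForm_eq] at h1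
    calc dissipationRate G dx F ρ * d ≤ d⁻¹ * rateForm G dx F ρ Φ * d :=
          mul_le_mul_of_nonneg_right h1 h0.le
      _ = rateForm G dx F ρ Φ := by field_simp

end

end DiscreteFP

namespace DiscreteFP

noncomputable section

/-! ### Uniqueness of solutions -/

theorem locallyLipschitzOn_comp {α β γ : Type*} [PseudoEMetricSpace α] [PseudoEMetricSpace β]
    [PseudoEMetricSpace γ] {g : β → γ} {f : α → β} {s : Set α} (hg : LocallyLipschitz g)
    (hf : LocallyLipschitzOn s f) : LocallyLipschitzOn s fun x => g (f x) := by
  intro x hx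
  obtain ⟨K, t, ht, hK⟩ := hf hx
  obtain ⟨L, u, hu, hL⟩ := hg (f x)
  refine ⟨L * K, t ∩ f ⁻¹' u, inter_mem ht (hf.continuousOn x hx hu), ?_⟩
  exact hL.comp (hK.mono Set.inter_subset_left) fun y hy => hy.2

theorem locallyLipschitzOn_prodMk {α β γ : Type*} [PseudoEMetricSpace α] [PseudoEMetricSpace β]
    [PseudoEMetricSpace γ] {g : α → γ} {f : α → β} {s : Set α} (hf : LocallyLipschitzOn s f)
    (hg : LocallyLipschitzOn s g) : LocallyLipschitzOn s fun x => (f x, g x) := by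
  intro x hx
  obtain ⟨K, t, ht, hK⟩ := hf hx
  obtain ⟨L, u, hu, hL⟩ := hg hx
  exact ⟨max K L, t ∩ u, inter_mem ht hu,
    (hK.mono Set.inter_subset_left).prodMk (hL.mono Set.inter_subset_right)⟩

theorem locallyLipschitzOn_mul {α : Type*} [PseudoEMetricSpace α] {f g : α → ℝ} {s : Set α}
    (hf : LocallyLipschitzOn s f) (hg : LocallyLipschitzOn s g) :
    LocallyLipschitzOn s fun x => f x * g x := by
  have h : LocallyLipschitz fun q : ℝ × ℝ => q.1 * q.2 :=
    (contDiff_fst.mul contDiff_snd : ContDiff ℝ 1 fun q : ℝ × ℝ => q.1 * q.2).locallyLipschitz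
  exact locallyLipschitzOn_comp h (locallyLipschitzOn_prodMk hf hg)

theorem locallyLipschitzOn_sub {α : Type*} [PseudoEMetricSpace α] {f g : α → ℝ} {s : Set α}
    (hf : LocallyLipschitzOn s f) (hg : LocallyLipschitzOn s g) :
    LocallyLipschitzOn s fun x => f x - g x := by
  have h : LocallyLipschitz fun q : ℝ × ℝ => q.1 - q.2 :=
    (contDiff_fst.sub contDiff_snd : ContDiff ℝ 1 fun q : ℝ × ℝ => q.1 - q.2).locallyLipschitz
  exact locallyLipschitzOn_comp h (locallyLipschitzOn_prodMk hf hg)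

theorem locallyLipschitzOn_add {α : Type*} [PseudoEMetricSpace α] {f g : α → ℝ} {s : Set α}
    (hf : LocallyLipschitzOn s f) (hg : LocallyLipschitzOn s g) :
    LocallyLipschitzOn s fun x => f x + g x := by
  have h : LocallyLipschitz fun q : ℝ × ℝ => q.1 + q.2 :=
    (contDiff_fst.add contDiff_snd : ContDiff ℝ 1 fun q : ℝ × ℝ => q.1 + q.2).locallyLipschitz
  exact locallyLipschitzOn_comp h (locallyLipschitzOn_prodMk hf hg)

theorem locallyLipschitzOn_const {α β : Type*} [PseudoEMetricSpace α] [PseudoEMetricSpace β]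
    (s : Set α) (c : β) : LocallyLipschitzOn s fun _ => c :=
  fun _ _ => ⟨0, Set.univ, univ_mem, (LipschitzWith.const c).lipschitzOnWith⟩

theorem locallyLipschitzOn_sum {α ι : Type*} [PseudoEMetricSpace α] {f : ι → α → ℝ} {s : Set α}
    (u : Finset ι) (hf : ∀ i, LocallyLipschitzOn s (f i)) :
    LocallyLipschitzOn s fun x => ∑ i ∈ u, f i x := by
  classical
  induction u using Finset.induction_on with
  | empty => simpa using locallyLipschitzOn_const s (0 : ℝ)
  | insert a u ha ih =>
    simp only [Finset.sum_insert ha]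
    exact locallyLipschitzOn_add (hf a) ih

theorem lipschitzOnWith_pi_of_forall {α ι : Type*} [PseudoEMetricSpace α] [Fintype ι]
    {f : α → ι → ℝ} {s : Set α} (h : ∀ i, ∃ K, LipschitzOnWith K (fun x => f x i) s) :
    ∃ K, LipschitzOnWith K f s := by
  choose K hK using h
  refine ⟨Finset.univ.sup K, fun x hx y hy => edist_pi_le_iff.2 fun i => ?_⟩
  refine (hK i hx hy).trans ?_
  gcongr
  exact Finset.le_sup (Finset.mem_univ i)

variable {V : Type*} [Fintype V] [DecidableEq V]

theorem locallyLipschitzOn_chemPot (v : V → ℝ) (w : Matrix V V ℝ) (β : ℝ) (i : V) :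
    LocallyLipschitzOn {ρ : V → ℝ | ∀ i, 0 < ρ i} fun ρ => chemPot v w β ρ i := by
  intro ρ hρ
  have hlog : ContDiffAt ℝ 1 (fun σ : V → ℝ => Real.log (σ i)) ρ :=
    (contDiff_apply ℝ ℝ i).contDiffAt.log (hρ i).ne'
  have hlin : ContDiffAt ℝ 1 (fun σ : V → ℝ => v i + ∑ j, w i j * σ j) ρ := by fun_prop
  have h : ContDiffAt ℝ 1 (fun σ => chemPot v w β σ i) ρ :=
    hlin.add (contDiffAt_const.mul (hlog.add contDiffAt_const))
  obtain ⟨K, t, ht, hK⟩ := h.exists_lipschitzOnWith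
  exact ⟨K, t, nhdsWithin_le_nhds ht, hK⟩

variable (G : SimpleGraph V) [DecidableRel G.Adj] (dx : ℝ)

/-- The positive part is Lipschitz but not differentiable, so only local Lipschitz continuity is
available; compactness makes it uniform. -/
theorem exists_lipschitzOnWith_schemeRHS (v : V → ℝ) {w : Matrix V V ℝ} (hw : w.IsSymm) (β : ℝ)
    {K : Set (V → ℝ)} (hK : IsCompact K) (hKpos : K ⊆ {ρ | ∀ i, 0 < ρ i}) :
    ∃ L, LipschitzOnWith L (schemeRHS G dx (freeEnergy v w β)) K := by
  refine lipschitzOnWith_pi_of_forall fun i => ?_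
  have hmax : LocallyLipschitz fun x : ℝ => max x 0 :=
    (LipschitzWith.id.max_const 0).locallyLipschitz
  have hap (j : V) : LocallyLipschitzOn {ρ : V → ℝ | ∀ i, 0 < ρ i} fun ρ => ρ j :=
    (LipschitzWith.eval j).locallyLipschitz.locallyLipschitzOn
  have hterm (a b : V) : LocallyLipschitzOn {ρ : V → ℝ | ∀ i, 0 < ρ i}
      fun ρ => ρ a * max (chemPot v w β ρ a - chemPot v w β ρ b) 0 :=
    locallyLipschitzOn_mul (hap a) <| locallyLipschitzOn_comp hmax <|
      locallyLipschitzOn_sub (locallyLipschitzOn_chemPot v w β a)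
        (locallyLipschitzOn_chemPot v w β b)
  have hall := locallyLipschitzOn_mul (locallyLipschitzOn_const _ (1 / dx ^ 2)) <|
    locallyLipschitzOn_sub
      (locallyLipschitzOn_sum (G.neighborFinset i) fun j => hterm j i)
      (locallyLipschitzOn_sum (G.neighborFinset i) fun j => hterm i j)
  obtain ⟨L, hL⟩ := (hall.mono hKpos).exists_lipschitzOnWith_of_compact hK
  refine ⟨L, fun ρ hρ σ hσ => ?_⟩
  have heq (τ : V → ℝ) (hτ : τ ∈ K) (j : V) :
      partialDeriv j (freeEnergy v w β) τ = chemPot v w β τ j :=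
    partialDeriv_freeEnergy hw (fun k => (hKpos hτ k).ne') j
  have := hL hρ hσ
  simpa only [schemeRHS, heq ρ hρ, heq σ hσ] using this

variable {G dx}

theorem IsSolution.pos {F : (V → ℝ) → ℝ} {ρ₀ : V → ℝ} {ρ : ℝ → V → ℝ}
    (h : IsSolution G dx F ρ₀ ρ) {t : ℝ} (ht : 0 ≤ t) (i : V) : 0 < ρ t i := (h.2 t ht).1.2 i

theorem IsSolution.continuousOn {F : (V → ℝ) → ℝ} {ρ₀ : V → ℝ} {ρ : ℝ → V → ℝ}
    (h : IsSolution G dx F ρ₀ ρ) : ContinuousOn ρ (Set.Ici 0) :=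
  fun t ht => (h.2 t ht).2.continuousWithinAt

/-- Two solutions that agree at one time agree at all times, before and after. -/
theorem IsSolution.eq_of_eq_at {v : V → ℝ} {w : Matrix V V ℝ} (hw : w.IsSymm) {β : ℝ}
    {ρ₀ σ₀ : V → ℝ} {ρ σ : ℝ → V → ℝ} (hρ : IsSolution G dx (freeEnergy v w β) ρ₀ ρ)
    (hσ : IsSolution G dx (freeEnergy v w β) σ₀ σ) {s : ℝ} (hs : 0 ≤ s) (h : ρ s = σ s)
    {t : ℝ} (ht : 0 ≤ t) : ρ t = σ t := by
  have hsub : Set.Icc 0 (max s t) ⊆ Set.Ici 0 := Set.Icc_subset_Ici_self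
  -- The two trajectories form a compact set of positive vectors, on which one Lipschitz constant
  -- serves.
  set K := ρ '' Set.Icc 0 (max s t) ∪ σ '' Set.Icc 0 (max s t)
  have hK : IsCompact K := (isCompact_Icc.image_of_continuousOn (hρ.continuousOn.mono hsub)).union
    (isCompact_Icc.image_of_continuousOn (hσ.continuousOn.mono hsub))
  have hKpos : K ⊆ {ρ | ∀ i, 0 < ρ i} := by
    rintro _ (⟨r, hr, rfl⟩ | ⟨r, hr, rfl⟩)
    · exact fun i => hρ.pos hr.1 i
    · exact fun i => hσ.pos hr.1 i
  obtain ⟨L, hL⟩ := exists_lipschitzOnWith_schemeRHS G dx v hw β hK hKpos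
  rcases le_total s t with hst | hst
  · have hmem (τ : ℝ) (hτ : τ ∈ Set.Ico s t) : τ ∈ Set.Icc 0 (max s t) :=
      ⟨hs.trans hτ.1, hτ.2.le.trans (le_max_right _ _)⟩
    exact ODE_solution_unique_of_mem_Icc_right (v := fun _ => schemeRHS G dx (freeEnergy v w β))
      (s := fun _ => K) (K := L) (fun _ _ => hL)
      (hρ.continuousOn.mono fun τ hτ => hs.trans hτ.1)
      (fun τ hτ => (hρ.2 τ (hs.trans hτ.1)).2.mono (Set.Ici_subset_Ici.2 (hs.trans hτ.1)))
      (fun τ hτ => Or.inl ⟨τ, hmem τ hτ, rfl⟩)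
      (hσ.continuousOn.mono fun τ hτ => hs.trans hτ.1)
      (fun τ hτ => (hσ.2 τ (hs.trans hτ.1)).2.mono (Set.Ici_subset_Ici.2 (hs.trans hτ.1)))
      (fun τ hτ => Or.inr ⟨τ, hmem τ hτ, rfl⟩) h ⟨hst, le_rfl⟩
  -- Backward uniqueness excludes the left endpoint, so every time used is positive and the
  -- derivative there is two-sided.
  · have hmem (τ : ℝ) (hτ : τ ∈ Set.Ioc t s) : τ ∈ Set.Icc 0 (max s t) :=
      ⟨ht.trans hτ.1.le, hτ.2.trans (le_max_left _ _)⟩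
    exact ODE_solution_unique_of_mem_Icc_left (v := fun _ => schemeRHS G dx (freeEnergy v w β))
      (s := fun _ => K) (K := L) (fun _ _ => hL)
      (hρ.continuousOn.mono fun τ hτ => ht.trans hτ.1)
      (fun τ hτ => ((hρ.2 τ (ht.trans hτ.1.le)).2.hasDerivAt
        (Ici_mem_nhds (ht.trans_lt hτ.1))).hasDerivWithinAt)
      (fun τ hτ => Or.inl ⟨τ, hmem τ hτ, rfl⟩)
      (hσ.continuousOn.mono fun τ hτ => ht.trans hτ.1)
      (fun τ hτ => ((hσ.2 τ (ht.trans hτ.1.le)).2.hasDerivAt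
        (Ici_mem_nhds (ht.trans_lt hτ.1))).hasDerivWithinAt)
      (fun τ hτ => Or.inr ⟨τ, hmem τ hτ, rfl⟩) h ⟨le_rfl, hst⟩

theorem isSolution_const {F : (V → ℝ) → ℝ} {ρ : V → ℝ} (h : ρ ∈ equilibria G dx F) :
    IsSolution G dx F ρ fun _ => ρ :=
  ⟨rfl, fun t _ => ⟨h.1, h.2 ▸ hasDerivWithinAt_const t _ ρ⟩⟩

end

end DiscreteFP

namespace DiscreteFP

noncomputable section

/-! ### Scalar differential inequalities -/

theorem antitoneOn_of_hasDerivWithinAt_Ici {f f' : ℝ → ℝ} {s : Set ℝ} (hs : Convex ℝ s)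
    (hs0 : s ⊆ Set.Ici 0) (hf : ∀ t, 0 ≤ t → HasDerivWithinAt f (f' t) (Set.Ici 0) t)
    (hf' : ∀ t ∈ s, f' t ≤ 0) : AntitoneOn f s :=
  antitoneOn_of_hasDerivWithinAt_nonpos hs
    (fun t ht => ((hf t (hs0 ht)).mono hs0).continuousWithinAt)
    (fun t ht => (hf t (hs0 (interior_subset ht))).mono (interior_subset.trans hs0))
    fun t ht => hf' t (interior_subset ht)

/-- If `y' = -d` and `c y ≤ d` on `s`, then `y` decays on `s` at the rate `c`. -/
theorem le_exp_mul_of_mul_le {y d : ℝ → ℝ} {c : ℝ} {s : Set ℝ} (hs : Convex ℝ s)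
    (hs0 : s ⊆ Set.Ici 0) (hy : ∀ t, 0 ≤ t → HasDerivWithinAt y (-d t) (Set.Ici 0) t)
    (h : ∀ t ∈ s, c * y t ≤ d t) {a b : ℝ} (ha : a ∈ s) (hb : b ∈ s) (hab : a ≤ b) :
    y b ≤ Real.exp (-c * (b - a)) * y a := by
  -- Gronwall with the integrating factor `exp (c (t - a))`.
  have hz (t : ℝ) (ht : 0 ≤ t) : HasDerivWithinAt (fun t => Real.exp (c * (t - a)) * y t)
      (Real.exp (c * (t - a)) * (c * 1) * y t + Real.exp (c * (t - a)) * -d t) (Set.Ici 0) t :=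
    ((((hasDerivWithinAt_id t _).sub_const a).const_mul c).exp).mul (hy t ht)
  have hanti := antitoneOn_of_hasDerivWithinAt_Ici hs hs0 hz fun t ht => by
    nlinarith [h t ht, Real.exp_pos (c * (t - a))]
  have := hanti ha hb hab
  simp only [sub_self, mul_zero, Real.exp_zero, one_mul] at this
  rw [neg_mul, Real.exp_neg, inv_mul_eq_div, le_div_iff₀ (Real.exp_pos _), mul_comm]
  exact this

/-- If `y' = -d`, `d' ≤ -c d` on `[T, ∞)` and `y, d → 0`, then `c y ≤ d` on `[T, ∞)`. -/
theorem mul_le_of_deriv_le {y d d' : ℝ → ℝ} {c T : ℝ} (hT : 0 ≤ T)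
    (hy : ∀ t, 0 ≤ t → HasDerivWithinAt y (-d t) (Set.Ici 0) t)
    (hd : ∀ t, 0 ≤ t → HasDerivWithinAt d (d' t) (Set.Ici 0) t)
    (h : ∀ t, T ≤ t → d' t ≤ -c * d t)
    (hy0 : Tendsto y atTop (𝓝 0)) (hd0 : Tendsto d atTop (𝓝 0)) {t : ℝ} (ht : T ≤ t) :
    c * y t ≤ d t := by
  -- `d - c y` is nonincreasing and tends to zero, hence is nonnegative.
  have hanti := antitoneOn_of_hasDerivWithinAt_Ici (convex_Ici T) (Set.Ici_subset_Ici.2 hT)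
    (fun t ht => (hd t ht).sub ((hy t ht).const_mul c)) fun t ht => by
      have := h t ht
      linarith
  have hlim : Tendsto (fun t => d t - c * y t) atTop (𝓝 0) := by
    simpa using hd0.sub (hy0.const_mul c)
  have : 0 ≤ d t - c * y t := by
    refine le_of_tendsto hlim ?_
    filter_upwards [eventually_ge_atTop t] with r hr
    exact hanti (Set.mem_Ici.2 ht) (Set.mem_Ici.2 (ht.trans hr)) hr
  linarith

/-- Squaring removes the kink of the positive part, so the dissipation stays differentiable where
neighbouring potentials coincide. -/
theorem hasDerivAt_max_zero_sq (x : ℝ) :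
    HasDerivAt (fun x : ℝ => max x 0 ^ 2) (2 * max x 0) x := by
  rcases lt_trichotomy x 0 with h | rfl | h
  · rw [max_eq_right h.le, mul_zero]
    refine (hasDerivAt_const x (0 : ℝ)).congr_of_eventuallyEq ?_
    filter_upwards [eventually_lt_nhds h] with y hy
    rw [max_eq_right hy.le]; ring
  · rw [max_self, mul_zero, hasDerivAt_iff_isLittleO]
    simp only [max_self, ne_eq, OfNat.ofNat_ne_zero, not_false_eq_true, zero_pow, sub_zero,
      smul_zero]
    have h1 : (fun x : ℝ => max x 0 ^ 2) =O[𝓝 0] fun x : ℝ => x ^ 2 :=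
      Asymptotics.IsBigO.of_norm_le fun x => by
        rw [Real.norm_eq_abs, abs_of_nonneg (sq_nonneg _)]
        rcases le_total x 0 with h | h
        · rw [max_eq_right h, zero_pow two_ne_zero]; exact sq_nonneg x
        · rw [max_eq_left h]
    refine h1.trans_isLittleO ?_
    simpa using Asymptotics.isLittleO_pow_pow (𝕜 := ℝ) (m := 1) (n := 2) one_lt_two
  · rw [max_eq_left h.le]
    have := hasDerivAt_pow 2 x
    refine (HasDerivAt.congr_of_eventuallyEq (by simpa using this) ?_)
    filter_upwards [eventually_gt_nhds h] with y hy
    rw [max_eq_left hy.le]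

variable {V : Type*} [Fintype V] [DecidableEq V]
  {G : SimpleGraph V} [DecidableRel G.Adj] {dx : ℝ}

/-! ### The free energy and its dissipation along a solution -/

theorem IsSolution.hasDerivWithinAt_freeEnergy (hdx : 0 < dx) {v : V → ℝ} {w : Matrix V V ℝ}
    (hw : w.IsSymm) {β : ℝ} {ρ₀ : V → ℝ} {ρ : ℝ → V → ℝ}
    (h : IsSolution G dx (freeEnergy v w β) ρ₀ ρ) {t : ℝ} (ht : 0 ≤ t) :
    HasDerivWithinAt (fun t => freeEnergy v w β (ρ t))
      (-dissipation G dx (ρ t) (chemPot v w β (ρ t))) (Set.Ici 0) t := by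
  have hne (i : V) : ρ t i ≠ 0 := (h.pos ht i).ne'
  refine ((hasFDerivAt_freeEnergy hw hne).comp_hasDerivWithinAt t (h.2 t ht).2).congr_deriv ?_
  rw [← sum_mul_schemeRHS_eq_neg_dissipation G hdx _ (ρ t)
    (fun i => partialDeriv_freeEnergy hw hne i)]
  simp

/-- Product rule: the squared gradients contribute `rateForm`, and the weights contribute a
dissipation with signed weights `dρ/dt`. -/
theorem IsSolution.hasDerivWithinAt_dissipation (hdx : 0 < dx) {v : V → ℝ} {w : Matrix V V ℝ}
    (hw : w.IsSymm) {β : ℝ} {ρ₀ : V → ℝ} {ρ : ℝ → V → ℝ}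
    (h : IsSolution G dx (freeEnergy v w β) ρ₀ ρ) {t : ℝ} (ht : 0 ≤ t) :
    HasDerivWithinAt (fun t => dissipation G dx (ρ t) (chemPot v w β (ρ t)))
      (-2 * rateForm G dx (freeEnergy v w β) (ρ t) (chemPot v w β (ρ t))
        + dissipation G dx (schemeRHS G dx (freeEnergy v w β) (ρ t)) (chemPot v w β (ρ t)))
      (Set.Ici 0) t := by
  have hne (i : V) : ρ t i ≠ 0 := (h.pos ht i).ne'
  set F := freeEnergy v w β with hF
  set p := chemPot v w β (ρ t)
  set q : V → ℝ := fun i => ∑ k, chemHess w β (ρ t) i k * schemeRHS G dx F (ρ t) k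
  have hpi (i : V) : HasDerivWithinAt (fun t => chemPot v w β (ρ t) i) (q i) (Set.Ici 0) t := by
    refine ((hasFDerivAt_chemPot v w β hne i).comp_hasDerivWithinAt t (h.2 t ht).2).congr_deriv ?_
    simp [q]
  have hg (i j : V) : HasDerivWithinAt (fun t => posGrad dx (chemPot v w β (ρ t)) i j ^ 2)
      (2 * posGrad dx p i j * ((q i - q j) / dx)) (Set.Ici 0) t :=
    (hasDerivAt_max_zero_sq _).comp_hasDerivWithinAt t (((hpi i).sub (hpi j)).div_const dx)
  have hρ (i : V) : HasDerivWithinAt (fun t => ρ t i) (schemeRHS G dx F (ρ t) i) (Set.Ici 0) t :=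
    hasDerivWithinAt_pi.1 (h.2 t ht).2 i
  have hsum := HasDerivWithinAt.fun_sum (u := Finset.univ) fun i _ =>
    HasDerivWithinAt.fun_sum (u := G.neighborFinset i) fun j _ => (hg i j).mul (hρ i)
  refine hsum.congr_deriv ?_
  -- Integration by parts against rows `i` and `j` of the Hessian; their difference produces
  -- `hCoeff`.
  have hqd (i j : V) : (q i - q j) / dx = - ∑ k, ∑ l ∈ G.neighborFinset k,
      hCoeff dx F (ρ t) i j k l * posGrad dx p k l * ρ t k := by
    have hd (i : V) := sum_mul_schemeRHS G hdx F (ρ t)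
      (fun i => partialDeriv_freeEnergy hw hne i) (chemHess w β (ρ t) i)
    simp only [q, hd, ← Finset.sum_neg_distrib, ← Finset.sum_sub_distrib, Finset.sum_div]
    refine Finset.sum_congr rfl fun k _ => Finset.sum_congr rfl fun l _ => ?_
    simp only [hCoeff, hF, hess_freeEnergy hw hne, chemHess_comm hw β (ρ t) k,
      chemHess_comm hw β (ρ t) l]
    field_simp
    ring
  simp only [hqd, Finset.sum_add_distrib]
  rw [dissipation, rateForm, Finset.mul_sum]
  congr 1
  refine Finset.sum_congr rfl fun i _ => ?_
  rw [Finset.mul_sum]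
  refine Finset.sum_congr rfl fun j _ => ?_
  rw [mul_neg, neg_mul, neg_mul, mul_right_comm, mul_assoc 2, mul_assoc 2, Finset.mul_sum]
  congr 2
  refine Finset.sum_congr rfl fun k _ => ?_
  rw [Finset.mul_sum]
  refine Finset.sum_congr rfl fun l _ => ?_
  simp only [posGrad]
  ring

/-! ### Perturbation of the decay rate near the limit -/

/-- How much the decay rate of the dissipation at `ρ` may fall short of `2 λ_F(ρ')`. -/
def rateDefect (G : SimpleGraph V) [DecidableRel G.Adj] (dx : ℝ) (F : (V → ℝ) → ℝ)
    (ρ' ρ : V → ℝ) : ℝ :=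
  (2 * (edgeNorm G (fun i j k l => rateCoeff dx F ρ i j k l - rateCoeff dx F ρ' i j k l)
      + dissipationRate G dx F ρ' * ∑ i, |ρ i - ρ' i|)
    + ∑ i, |schemeRHS G dx F ρ i|) * ∑ i, 1 / ρ i

/-- Coercivity holds at `ρ'` with weights `ρ'`. Replacing the coefficients, the weights and `dρ/dt`
costs multiples of the unit-weight dissipation, which `∑ 1 / ρ i` converts back to weights `ρ`. -/
theorem neg_two_mul_rateForm_add_le (F : (V → ℝ) → ℝ) {ρ ρ' : V → ℝ} (hρ : ∀ i, 0 < ρ i)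
    (hρ' : ∀ i, 0 < ρ' i) (hpos : 0 ≤ dissipationRate G dx F ρ') (Φ : V → ℝ) :
    -2 * rateForm G dx F ρ Φ + dissipation G dx (schemeRHS G dx F ρ) Φ
      ≤ -(2 * dissipationRate G dx F ρ' - rateDefect G dx F ρ' ρ) * dissipation G dx ρ Φ := by
  have h1 := neg_edgeForm_le G dx
    (fun i j k l => rateCoeff dx F ρ i j k l - rateCoeff dx F ρ' i j k l) Φ
  rw [edgeForm_sub, ← rateForm_eq, ← rateForm_eq] at h1
  have h2 := dissipation_le_sum_abs G dx (ρ - ρ') Φ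
  rw [dissipation_sub] at h2
  have h3 := dissipation_le_sum_abs G dx (schemeRHS G dx F ρ) Φ
  have h4 := dissipationRate_mul_le G dx F hρ' Φ
  have h5 := dissipation_one_le G dx hρ Φ
  have h6 := mul_le_mul_of_nonneg_left h2 hpos
  have hE : 0 ≤ edgeNorm G
      fun i j k l => rateCoeff dx F ρ i j k l - rateCoeff dx F ρ' i j k l :=
    Finset.sum_nonneg fun i _ => Finset.sum_nonneg fun j _ =>
      Finset.sum_nonneg fun k _ => Finset.sum_nonneg fun l _ => abs_nonneg _
  have hA : 0 ≤ ∑ i, |ρ i - ρ' i| := Finset.sum_nonneg fun i _ => abs_nonneg _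
  have hR : 0 ≤ ∑ i, |schemeRHS G dx F ρ i| := Finset.sum_nonneg fun i _ => abs_nonneg _
  have h7 := mul_le_mul_of_nonneg_left h5
    (add_nonneg (mul_nonneg zero_le_two (add_nonneg hE (mul_nonneg hpos hA))) hR)
  simp only [Pi.sub_apply] at h6
  rw [rateDefect]
  linarith

/-- Everything is continuous at the positive point `ρ'`: the coefficient and weight errors vanish,
the right-hand side vanishes by equilibrium, and `∑ 1 / ρ i` stays bounded. -/
theorem tendsto_rateDefect {v : V → ℝ} {w : Matrix V V ℝ} (hw : w.IsSymm) {β : ℝ}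
    {ρ₀ ρ' : V → ℝ} {ρ : ℝ → V → ℝ} (h : IsSolution G dx (freeEnergy v w β) ρ₀ ρ)
    (heq : ρ' ∈ equilibria G dx (freeEnergy v w β)) (hlim : Tendsto ρ atTop (𝓝 ρ')) :
    Tendsto (fun t => rateDefect G dx (freeEnergy v w β) ρ' (ρ t)) atTop (𝓝 0) := by
  set F := freeEnergy v w β with hF
  have hρ (i : V) : Tendsto (fun t => ρ t i) atTop (𝓝 (ρ' i)) := tendsto_pi_nhds.1 hlim i
  have hne (i : V) : ρ' i ≠ 0 := (heq.1.2 i).ne'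
  have hhess (i k : V) : Tendsto (fun t => hess F (ρ t) i k) atTop (𝓝 (hess F ρ' i k)) := by
    rw [hF, hess_freeEnergy hw hne]
    have : Tendsto (fun t => chemHess w β (ρ t) k i) atTop (𝓝 (chemHess w β ρ' k i)) := by
      unfold chemHess
      refine tendsto_const_nhds.add ?_
      split_ifs
      · exact tendsto_const_nhds.div (hρ k) (hne k)
      · exact tendsto_const_nhds
    refine this.congr' ?_
    filter_upwards [eventually_ge_atTop 0] with t ht
    rw [hess_freeEnergy hw fun i => (h.pos ht i).ne']
  have hcoeff (i j k l : V) :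
      Tendsto (fun t => |rateCoeff dx F (ρ t) i j k l - rateCoeff dx F ρ' i j k l|) atTop
        (𝓝 0) := by
    have : Tendsto (fun t => rateCoeff dx F (ρ t) i j k l) atTop
        (𝓝 (rateCoeff dx F ρ' i j k l)) :=
      (((((hhess i k).add (hhess j l)).sub (hhess i l)).sub (hhess j k)).div_const _).mul (hρ i)
        |>.mul (hρ k)
    simpa using (this.sub_const (rateCoeff dx F ρ' i j k l)).abs
  have hE : Tendsto (fun t => edgeNorm G
      fun i j k l => rateCoeff dx F (ρ t) i j k l - rateCoeff dx F ρ' i j k l) atTop (𝓝 0) := by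
    have := tendsto_finsetSum Finset.univ fun i _ =>
      tendsto_finsetSum (G.neighborFinset i) fun j _ =>
      tendsto_finsetSum Finset.univ fun k _ =>
      tendsto_finsetSum (G.neighborFinset k) fun l _ => hcoeff i j k l
    simpa only [edgeNorm, Finset.sum_const_zero] using this
  have hA : Tendsto (fun t => ∑ i, |ρ t i - ρ' i|) atTop (𝓝 0) := by
    have := tendsto_finsetSum Finset.univ fun i _ => ((hρ i).sub_const (ρ' i)).abs
    simpa using this
  have hchem (i : V) : Tendsto (fun t => partialDeriv i F (ρ t)) atTop
      (𝓝 (partialDeriv i F ρ')) := by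
    rw [hF, partialDeriv_freeEnergy hw hne]
    refine ((hasFDerivAt_chemPot v w β hne i).continuousAt.tendsto.comp hlim).congr' ?_
    filter_upwards [eventually_ge_atTop 0] with t ht
    exact (partialDeriv_freeEnergy hw (fun i => (h.pos ht i).ne') i).symm
  have hrhs (i : V) : Tendsto (fun t => |schemeRHS G dx F (ρ t) i|) atTop (𝓝 0) := by
    have h0 : |schemeRHS G dx F ρ' i| = 0 := by rw [heq.2]; simp
    rw [← h0]
    refine Tendsto.abs (tendsto_const_nhds.mul (Tendsto.sub ?_ ?_))
    · exact tendsto_finsetSum _ fun j _ =>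
        (hρ j).mul (((hchem j).sub (hchem i)).max tendsto_const_nhds)
    · exact tendsto_finsetSum _ fun j _ =>
        (hρ i).mul (((hchem i).sub (hchem j)).max tendsto_const_nhds)
  have hR : Tendsto (fun t => ∑ i, |schemeRHS G dx F (ρ t) i|) atTop (𝓝 0) := by
    simpa using tendsto_finsetSum Finset.univ fun i _ => hrhs i
  have hM : Tendsto (fun t => ∑ i, 1 / ρ t i) atTop (𝓝 (∑ i, 1 / ρ' i)) :=
    tendsto_finsetSum _ fun i _ => tendsto_const_nhds.div (hρ i) (hne i)
  simpa [rateDefect] using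
    (((hE.add (hA.const_mul (dissipationRate G dx F ρ'))).const_mul 2).add hR).mul hM

/-! ### From dissipation control to exponential decay -/

/-- A point of the simplex without dissipation is an equilibrium. -/
theorem mem_equilibria_of_dissipation_eq_zero (hdx : 0 < dx) {v : V → ℝ} {w : Matrix V V ℝ}
    (hw : w.IsSymm) {β : ℝ} {ρ : V → ℝ} (hρ : ρ ∈ openSimplex V)
    (h0 : dissipation G dx ρ (chemPot v w β ρ) = 0) :
    ρ ∈ equilibria G dx (freeEnergy v w β) := by
  refine ⟨hρ, funext fun i => ?_⟩
  rw [schemeRHS_eq G hdx _ ρ (partialDeriv_freeEnergy hw fun i => (hρ.2 i).ne'),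
    Finset.sum_eq_zero, Finset.sum_eq_zero]
  · simp
  · intro j hj
    rw [posGrad_eq_zero G dx hρ.2 h0 hj, zero_mul]
  · intro j hj
    rw [posGrad_eq_zero G dx hρ.2 h0 (by simpa [G.adj_comm] using hj), zero_mul]

/-- Along a solution converging to an equilibrium, the dissipation eventually controls the
relative free energy. -/
theorem IsSolution.exists_mul_le_dissipation (hdx : 0 < dx) {v : V → ℝ} {w : Matrix V V ℝ}
    (hw : w.IsSymm) {β : ℝ} {ρ₀ ρ' : V → ℝ} {ρ : ℝ → V → ℝ}
    (h : IsSolution G dx (freeEnergy v w β) ρ₀ ρ)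
    (heq : ρ' ∈ equilibria G dx (freeEnergy v w β)) (hlim : Tendsto ρ atTop (𝓝 ρ'))
    (hpos : 0 ≤ dissipationRate G dx (freeEnergy v w β) ρ') {ε : ℝ} (hε : 0 < ε) :
    ∃ T : ℝ, 0 < T ∧ ∀ t, T ≤ t →
      2 * (dissipationRate G dx (freeEnergy v w β) ρ' - ε) *
          (freeEnergy v w β (ρ t) - freeEnergy v w β ρ')
        ≤ dissipation G dx (ρ t) (chemPot v w β (ρ t)) := by
  have hne (i : V) : ρ' i ≠ 0 := (heq.1.2 i).ne'
  obtain ⟨T, hT⟩ := eventually_atTop.1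
    ((tendsto_rateDefect hw h heq hlim).eventually_lt_const (by positivity : 0 < 2 * ε))
  refine ⟨max T 1, by positivity, fun t ht => ?_⟩
  have hT1 : (0 : ℝ) ≤ max T 1 := by positivity
  have hρ (i : V) : Tendsto (fun t => ρ t i) atTop (𝓝 (ρ' i)) := tendsto_pi_nhds.1 hlim i
  have hchem (i : V) : Tendsto (fun t => chemPot v w β (ρ t) i) atTop
      (𝓝 (chemPot v w β ρ' i)) :=
    (hasFDerivAt_chemPot v w β hne i).continuousAt.tendsto.comp hlim
  refine mul_le_of_deriv_le hT1
    (fun t ht => (h.hasDerivWithinAt_freeEnergy hdx hw ht).sub_const _)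
    (fun t ht => h.hasDerivWithinAt_dissipation hdx hw ht) (fun t ht => ?_) ?_ ?_ ht
  · have ht0 := hT1.trans ht
    refine (neg_two_mul_rateForm_add_le _ (h.pos ht0) heq.1.2 hpos _).trans ?_
    have hd := dissipation_nonneg G dx (fun i => (h.pos ht0 i).le) (chemPot v w β (ρ t))
    refine mul_le_mul_of_nonneg_right ?_ hd
    have := hT t ((le_max_left _ _).trans ht)
    linarith
  · have := (hasFDerivAt_freeEnergy (v := v) (β := β) hw hne).continuousAt.tendsto.comp hlim
    simpa using this.sub_const (freeEnergy v w β ρ')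
  · have h0 : dissipation G dx ρ' (chemPot v w β ρ') = 0 := by
      have := sum_mul_schemeRHS_eq_neg_dissipation G hdx _ ρ'
        (fun i => partialDeriv_freeEnergy (v := v) (β := β) hw hne i)
      simpa [heq.2] using this.symm
    rw [← h0]
    exact tendsto_finsetSum _ fun i _ => tendsto_finsetSum _ fun j _ =>
      (((((hchem i).sub (hchem j)).div_const dx).max tendsto_const_nhds).pow 2).mul (hρ i)

theorem IsSolution.exists_decay (hdx : 0 < dx) {v : V → ℝ} {w : Matrix V V ℝ}
    (hw : w.IsSymm) {β : ℝ} {ρ₀ ρ' : V → ℝ} {ρ : ℝ → V → ℝ}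
    (h : IsSolution G dx (freeEnergy v w β) ρ₀ ρ)
    (heq : ρ' ∈ equilibria G dx (freeEnergy v w β)) (hlim : Tendsto ρ atTop (𝓝 ρ'))
    (hpos : 0 < dissipationRate G dx (freeEnergy v w β) ρ') :
    ∃ C : ℝ, 0 < C ∧ ∀ t, 0 ≤ t →
      freeEnergy v w β (ρ t) - freeEnergy v w β ρ'
        ≤ Real.exp (-C * t) * (freeEnergy v w β ρ₀ - freeEnergy v w β ρ') := by
  have hd0 (t : ℝ) (ht : 0 ≤ t) : 0 ≤ dissipation G dx (ρ t) (chemPot v w β (ρ t)) :=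
    dissipation_nonneg G dx (fun i => (h.pos ht i).le) _
  have hder (t : ℝ) (ht : 0 ≤ t) :=
    (h.hasDerivWithinAt_freeEnergy hdx hw ht).sub_const (freeEnergy v w β ρ')
  -- If the dissipation vanishes at some time, the trajectory is constant and both sides are zero,
  -- so any `C` works. Otherwise it has a positive minimum on compact intervals.
  by_cases hs : ∃ s, 0 ≤ s ∧ dissipation G dx (ρ s) (chemPot v w β (ρ s)) = 0
  · obtain ⟨s, hs, hs0⟩ := hs
    have hsol := isSolution_const (mem_equilibria_of_dissipation_eq_zero hdx hw (h.2 s hs).1 hs0)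
    have hconst (t : ℝ) (ht : 0 ≤ t) : ρ t = ρ s := h.eq_of_eq_at hw hsol hs rfl ht
    have hρ' : ρ' = ρ s := tendsto_nhds_unique hlim <| tendsto_const_nhds.congr' <| by
      filter_upwards [eventually_ge_atTop 0] with t ht
      exact (hconst t ht).symm
    refine ⟨1, one_pos, fun t ht => ?_⟩
    rw [← h.1, hconst t ht, hconst 0 le_rfl, hρ']
    simp
  · push Not at hs
    obtain ⟨T, hT, hTd⟩ := h.exists_mul_le_dissipation hdx hw heq hlim hpos.le (half_pos hpos)
    have hcont : ContinuousOn (fun t => dissipation G dx (ρ t) (chemPot v w β (ρ t)))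
        (Set.Icc 0 T) := fun t ht =>
      ((h.hasDerivWithinAt_dissipation hdx hw ht.1).mono Set.Icc_subset_Ici_self).continuousWithinAt
    obtain ⟨m, hm, hmin⟩ := isCompact_Icc.exists_isMinOn (Set.nonempty_Icc.2 hT.le) hcont
    set d := dissipation G dx (ρ m) (chemPot v w β (ρ m)) with hd
    have hdpos : 0 < d := lt_of_le_of_ne (hd0 m hm.1) (hs m hm.1).symm
    have hanti := antitoneOn_of_hasDerivWithinAt_Ici (convex_Ici 0) subset_rfl hder
      fun t ht => neg_nonpos.2 (hd0 t ht)
    have hylim : Tendsto (fun t => freeEnergy v w β (ρ t) - freeEnergy v w β ρ') atTop (𝓝 0) := by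
      have := (hasFDerivAt_freeEnergy (v := v) (β := β) hw
        fun i => (heq.1.2 i).ne').continuousAt.tendsto.comp hlim
      simpa using this.sub_const (freeEnergy v w β ρ')
    have hy (t : ℝ) (ht : 0 ≤ t) : 0 ≤ freeEnergy v w β (ρ t) - freeEnergy v w β ρ' := by
      refine le_of_tendsto hylim ?_
      filter_upwards [eventually_ge_atTop t] with r hr
      exact hanti (Set.mem_Ici.2 ht) (Set.mem_Ici.2 (ht.trans hr)) hr
    set lam := dissipationRate G dx (freeEnergy v w β) ρ' with hlam
    set y₀ := freeEnergy v w β (ρ 0) - freeEnergy v w β ρ' with hy₀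
    have hy₀' : 0 ≤ y₀ := hy 0 le_rfl
    -- After `T`, the choice `ε = lam / 2` gives rate `lam`. Before `T`, `y ≤ y₀` and the
    -- dissipation is at least its minimum `d`; the `+ 1` guards against `y₀ = 0`.
    refine ⟨min lam (d / (y₀ + 1)), lt_min hpos (by positivity), fun t ht => ?_⟩
    have := le_exp_mul_of_mul_le (c := min lam (d / (y₀ + 1))) (convex_Ici 0) subset_rfl hder
      (fun t ht => ?_) (Set.mem_Ici.2 le_rfl) (Set.mem_Ici.2 ht) ht
    · simpa [h.1] using this
    have hyt := hy t ht
    rcases le_total T t with hTt | hTt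
    · refine (mul_le_mul_of_nonneg_right (min_le_left _ _) hyt).trans ((le_of_eq ?_).trans
        (hTd t hTt))
      ring
    · refine (mul_le_mul_of_nonneg_right (min_le_right _ _) hyt).trans ?_
      refine le_trans ?_ (hmin ⟨ht, hTt⟩)
      rw [div_mul_eq_mul_div, div_le_iff₀ (by positivity)]
      refine mul_le_mul_of_nonneg_left ?_ hdpos.le
      have := hanti (Set.mem_Ici.2 le_rfl) ht ht
      exact this.trans (by linarith)

end

end DiscreteFP

theorem theorem3p2 {V : Type*} [Fintype V] [DecidableEq V]
    (G : SimpleGraph V) [DecidableRel G.Adj] (hG : G.Connected)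
    (dx : ℝ) (hdx : 0 < dx) (β : ℝ) (hβ : 0 < β)
    (v : V → ℝ) (w : Matrix V V ℝ) (hw : w.IsSymm)
    (F : (V → ℝ) → ℝ) (hF : F = DiscreteFP.freeEnergy v w β)
    (ρ₀ ρinf : V → ℝ)
    (hinf : DiscreteFP.IsIsolatedEquilibrium G dx F ρinf)
    (hpos : 0 < DiscreteFP.dissipationRate G dx F ρinf) :
    (∃ C : ℝ, 0 < C ∧
      ∀ ρ : ℝ → V → ℝ, DiscreteFP.IsSolution G dx F ρ₀ ρ → Tendsto ρ atTop (𝓝 ρinf) →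
        ∀ t : ℝ, 0 ≤ t →
          F (ρ t) - F ρinf ≤ Real.exp (-C * t) * (F ρ₀ - F ρinf)) ∧
    ∀ ε : ℝ, 0 < ε → ∃ T : ℝ, 0 < T ∧
      ∀ ρ : ℝ → V → ℝ, DiscreteFP.IsSolution G dx F ρ₀ ρ → Tendsto ρ atTop (𝓝 ρinf) →
        ∀ t : ℝ, T < t →
          F (ρ t) - F ρinf ≤
            Real.exp (-2 * (DiscreteFP.dissipationRate G dx F ρinf - ε) * (t - T)) *
              (F (ρ T) - F ρinf) := by
  subst hF
  -- The constants precede the trajectory, so they are taken from one convergent solution `σ` and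
  -- transferred by uniqueness. Without such a solution the claims are vacuous.
  by_cases hex : ∃ σ : ℝ → V → ℝ,
      DiscreteFP.IsSolution G dx (DiscreteFP.freeEnergy v w β) ρ₀ σ ∧ Tendsto σ atTop (𝓝 ρinf)
  · obtain ⟨σ, hσ, hσlim⟩ := hex
    have huniq (ρ : ℝ → V → ℝ)
        (hρ : DiscreteFP.IsSolution G dx (DiscreteFP.freeEnergy v w β) ρ₀ ρ) (t : ℝ)
        (ht : 0 ≤ t) : ρ t = σ t :=
      hρ.eq_of_eq_at hw hσ le_rfl (hρ.1.trans hσ.1.symm) ht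
    refine ⟨?_, fun ε hε => ?_⟩
    · obtain ⟨C, hC, h⟩ := hσ.exists_decay hdx hw hinf.1 hσlim hpos
      refine ⟨C, hC, fun ρ hρ _ t ht => ?_⟩
      rw [huniq ρ hρ t ht]
      exact h t ht
    · obtain ⟨T, hT, h⟩ := hσ.exists_mul_le_dissipation hdx hw hinf.1 hσlim hpos.le hε
      refine ⟨T, hT, fun ρ hρ _ t ht => ?_⟩
      rw [huniq ρ hρ t (hT.le.trans ht.le), huniq ρ hρ T hT.le, neg_mul]
      exact DiscreteFP.le_exp_mul_of_mul_le (convex_Ici T) (Set.Ici_subset_Ici.2 hT.le)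
        (fun t ht => (hσ.hasDerivWithinAt_freeEnergy hdx hw ht).sub_const _) h
        (Set.mem_Ici.2 le_rfl) (Set.mem_Ici.2 ht.le) ht.le
  · exact ⟨⟨1, one_pos, fun ρ hρ hlim => absurd ⟨ρ, hρ, hlim⟩ hex⟩,
      fun ε _ => ⟨1, one_pos, fun ρ hρ hlim => absurd ⟨ρ, hρ, hlim⟩ hex⟩⟩
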